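/- **Theorem 4.8.** Let $n\ge 1$, let $I\subset\mathbb R$ be an open interval, $\xi\colon I\to(0,\infty)$ a smooth function and $(P^n,g_P)$ a Riemannian manifold (complete or not), and let $N^{n+1}=I\times_\xi P^n$ be the product $I\times P$ with the warped product metric $dt^2+\xi(t)^2g_P$. Let $\varphi\colon M^n\to N^{n+1}$ be a smooth isometric immersion of a non-empty Riemannian manifold $M^n$, and let $h=\pi_I\circ\varphi\colon M\to I$ be its height function, where $\pi_I\colon I\times P\to I$ is the projection. Let $H=\frac1n\operatorname{tr}\alpha$ be the (normalized) mean curvature vector of $\varphi$, where $\alpha$ is its second fundamental form. Suppose that $M$ has an Omori–Yau pair $(\mathcal G,\gamma)$ for the Laplacian, that is, $\mathcal G\in C^1([0,\infty))$ with values in $(0,\infty)$ and $\gamma\in C^2(M)$ with values in $[0,\infty)$ satisfy: 1. $\gamma(x)\to+\infty$ as $x\to\infty$ in $M$ (that is, as $x$ leaves every compact subset of $M$); 2. $\mathcal G'\ge 0$ on $[0,\infty)$ and $\int_0^{+\infty}\frac{ds}{\sqrt{\mathcal G(s)}}=+\infty$; 3. there is a constant $A>0$ with $|\operatorname{grad}\gamma|\le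 A\sqrt{\mathcal G(\gamma)}\left(\int_0^{\gamma}\frac{ds}{\sqrt{\mathcal G(s)}}+1\right)$ off a compact subset of $M$; 4. there is a constant $B>0$ with $\triangle\gamma\le B\sqrt{\mathcal G(\gamma)}\left(\int_0^{\gamma}\frac{ds}{\sqrt{\mathcal G(s)}}+1\right)$ off a compact subset of $M$. Put $\psi(t)=\log\left(\int_0^t\frac{ds}{\sqrt{\mathcal G(s)}}+1\right)$ and suppose that $$\lim_{x\to\infty}\frac{h(x)}{\psi(\gamma(x))}=0 .$$ Then, with $\mathcal H(t)=\xi'(t)/\xi(t)$, $$\sup_{M}|H|\;\ge\;\inf_{M}\mathcal H(h),$$ where the supremum and the infimum are taken in $[-\infty,+\infty]$. -/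

import Mathlib

open scoped Manifold ContDiff Topology
open Bundle

noncomputable section

namespace OmoriYau

/-- The model space `ℝⁿ`. -/
abbrev Eu (n : ℕ) : Type := EuclideanSpace ℝ (Fin n)

/-- A field of bilinear forms on the tangent spaces of a manifold (a covariant `2`-tensor). -/
abbrev BilinField {E H : Type*} [NormedAddCommGroup E] [NormedSpace ℝ E] [TopologicalSpace H]
    (I : ModelWithCorners ℝ E H) (X : Type*) [TopologicalSpace X] [ChartedSpace H X] : Type _ :=
  ∀ x : X, TangentSpace I x →L[ℝ] TangentSpace I x →L[ℝ] ℝ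

/-- A smooth Riemannian metric on a smooth `n`-manifold. -/
abbrev RMetric (n : ℕ) (X : Type*) [TopologicalSpace X] [ChartedSpace (Eu n) X]
    [IsManifold 𝓘(ℝ, Eu n) ∞ X] : Type _ :=
  ContMDiffRiemannianMetric 𝓘(ℝ, Eu n) ∞ (Eu n) (fun x : X ↦ TangentSpace 𝓘(ℝ, Eu n) x)

section Local

variable {E : Type*} [NormedAddCommGroup E] [NormedSpace ℝ E]

/-- The Christoffel symbols `Γ_u(v, w)` of a metric `G` on an open subset of a vector space,
defined by `G_u(Γ_u(v, w), z) = ½ (DG(v)(w, z) + DG(w)(v, z) - DG(z)(v, w))` for all `z`. -/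
def christoffel (G : E → E →L[ℝ] E →L[ℝ] ℝ) (u v w : E) : E :=
  (G u).inverse ((1 / 2 : ℝ) •
    (fderiv ℝ G u v w + fderiv ℝ G u w v - ((fderiv ℝ G u).flip v).flip w))

end Local

/-- The trace `∑ᵢⱼ gⁱʲ B(eᵢ, eⱼ)` of a (vector valued) bilinear map `B` with respect to an inner
product `g` on `ℝⁿ`; here `∑ⱼ gⁱʲ eⱼ` is written as the vector dual to the `i`-th coordinate. -/
def metricTrace {n : ℕ} {F : Type*} [AddCommGroup F] (g : Eu n →L[ℝ] Eu n →L[ℝ] ℝ)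
    (B : Eu n → Eu n → F) : F :=
  ∑ i : Fin n, B (EuclideanSpace.single i 1) (g.inverse (EuclideanSpace.proj i))

section Charts

variable {E H : Type*} [NormedAddCommGroup E] [NormedSpace ℝ E] [TopologicalSpace H]
  {I : ModelWithCorners ℝ E H} {X : Type*} [TopologicalSpace X] [ChartedSpace H X]

/-- The coordinate expression of a field of bilinear forms in the preferred chart at `x`: its
pullback under the inverse of the chart. -/
def inChart (g : BilinField I X) (x : X) (u : E) : E →L[ℝ] E →L[ℝ] ℝ :=
  let p : X := (extChartAt I x).symm u
  let D : E →L[ℝ] E := mfderiv 𝓘(ℝ, E) I (extChartAt I x).symm u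
  let b : E →L[ℝ] E →L[ℝ] ℝ := g p
  b.bilinearComp D D

/-- The Riemannian gradient of `f` at `x`: `g(grad f, v) = df(v)` for all `v`. -/
def gradient (g : BilinField I X) (f : X → ℝ) (x : X) : TangentSpace I x :=
  let b : E →L[ℝ] E →L[ℝ] ℝ := g x
  let df : E →L[ℝ] ℝ := mfderiv I 𝓘(ℝ, ℝ) f x
  b.inverse df

/-- The length of a tangent vector. -/
def vecNorm (g : BilinField I X) {x : X} (v : TangentSpace I x) : ℝ := Real.sqrt (g x v v)

/-- The Riemannian Hessian of `f` at `x`, in the preferred chart at `x` (whose coordinates are the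
ones used by `TangentSpace I x`): `∂ᵢ∂ⱼ f - Γᵏᵢⱼ ∂ₖ f`. The manifold has no boundary. -/
def hessian (g : BilinField I X) (f : X → ℝ) (x : X) (v w : E) : ℝ :=
  let f' : E → ℝ := f ∘ (extChartAt I x).symm
  let u : E := extChartAt I x x
  fderiv ℝ (fderiv ℝ f') u v w - fderiv ℝ f' u (christoffel (inChart g x) u v w)

variable {E' H' : Type*} [NormedAddCommGroup E'] [NormedSpace ℝ E'] [TopologicalSpace H']
  {I' : ModelWithCorners ℝ E' H'} {Y : Type*} [TopologicalSpace Y] [ChartedSpace H' Y]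

/-- `φ` is a smooth isometric immersion (injectivity of the differential follows from the
preservation of the metric). -/
def IsIsometricImmersion (gX : BilinField I X) (gY : BilinField I' Y) (φ : X → Y) : Prop :=
  ContMDiff I I' ∞ φ ∧ ∀ (x : X) (v w : TangentSpace I x),
    gY (φ x) (mfderiv I I' φ x v) (mfderiv I I' φ x w) = gX x v w

/-- The second fundamental form `α(v, w) = ∇̄_v (dφ w) - dφ(∇_v w)` of `φ` at `x`, in the preferred
charts at `x` and at `φ x`: `αᵃᵢⱼ = ∂ᵢ∂ⱼ φᵃ - Γᵏᵢⱼ ∂ₖ φᵃ + Γ̄ᵃ_bc ∂ᵢ φᵇ ∂ⱼ φᶜ`.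
The manifolds have no boundary. -/
def secondFundamentalForm (gX : BilinField I X) (gY : BilinField I' Y) (φ : X → Y) (x : X)
    (v w : E) : E' :=
  let φ' : E → E' := writtenInExtChartAt I I' x φ
  let u : E := extChartAt I x x
  fderiv ℝ (fderiv ℝ φ') u v w - fderiv ℝ φ' u (christoffel (inChart gX x) u v w)
    + christoffel (inChart gY (φ x)) (φ' u) (fderiv ℝ φ' u v) (fderiv ℝ φ' u w)

end Charts

section Submanifold

variable {n : ℕ} {M : Type*} [TopologicalSpace M] [ChartedSpace (Eu n) M]

/-- The Laplace-Beltrami operator: the trace of the Hessian. -/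
def laplacian (g : BilinField 𝓘(ℝ, Eu n) M) (f : M → ℝ) (x : M) : ℝ :=
  metricTrace (g x) (hessian g f x)

variable {E' H' : Type*} [NormedAddCommGroup E'] [NormedSpace ℝ E'] [TopologicalSpace H']
  {I' : ModelWithCorners ℝ E' H'} {Y : Type*} [TopologicalSpace Y] [ChartedSpace H' Y]

/-- The (normalized) mean curvature vector `H = (1/n) tr α` of an immersed `n`-manifold. -/
def meanCurvature (gM : BilinField 𝓘(ℝ, Eu n) M) (gY : BilinField I' Y) (φ : M → Y) (x : M) :
    TangentSpace I' (φ x) :=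
  let trα : E' := metricTrace (gM x) (secondFundamentalForm gM gY φ x)
  (n : ℝ)⁻¹ • trα

end Submanifold

/-- The warped product metric `dt² + ξ(t)² g_P` on `ℝ × P`. If `ξ` is smooth and positive on an open
interval `I`, the open subset `I × P` with this metric is the warped product `I ×_ξ P`. -/
def warpedMetric {n : ℕ} {P : Type*} [TopologicalSpace P] [ChartedSpace (Eu n) P]
    (ξ : ℝ → ℝ) (gP : BilinField 𝓘(ℝ, Eu n) P) :
    BilinField (𝓘(ℝ, ℝ).prod 𝓘(ℝ, Eu n)) (ℝ × P) := fun y ↦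
  let b : Eu n →L[ℝ] Eu n →L[ℝ] ℝ := gP y.2
  let fst : ℝ × Eu n →L[ℝ] ℝ := ContinuousLinearMap.fst ℝ ℝ (Eu n)
  let snd : ℝ × Eu n →L[ℝ] Eu n := ContinuousLinearMap.snd ℝ ℝ (Eu n)
  let r : ℝ × Eu n →L[ℝ] ℝ × Eu n →L[ℝ] ℝ :=
    (ContinuousLinearMap.mul ℝ ℝ).bilinearComp fst fst + (ξ y.1) ^ 2 • b.bilinearComp snd snd
  r

/-- `∫₀ᵗ ds / √(G s) + 1`. -/
def growth (G : ℝ → ℝ) (t : ℝ) : ℝ := (∫ s in (0 : ℝ)..t, 1 / Real.sqrt (G s)) + 1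

/-- `ψ(t) = log (∫₀ᵗ ds / √(G s) + 1)`. -/
def psi (G : ℝ → ℝ) (t : ℝ) : ℝ := Real.log (growth G t)

/-- `(G, γ)` is an Omori-Yau pair for the Laplacian on the Riemannian manifold `(M, g)`.
Only the values of `G` on `[0, ∞)` matter. -/
structure IsOmoriYauPair {n : ℕ} {M : Type*} [TopologicalSpace M] [ChartedSpace (Eu n) M]
    (g : BilinField 𝓘(ℝ, Eu n) M) (G : ℝ → ℝ) (γ : M → ℝ) : Prop where
  G_contDiff : ContDiffOn ℝ 1 G (Set.Ici 0)
  G_pos : ∀ t, 0 ≤ t → 0 < G t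
  G_deriv_nonneg : ∀ t, 0 ≤ t → 0 ≤ derivWithin G (Set.Ici 0) t
  G_integral : Filter.Tendsto (fun t : ℝ ↦ ∫ s in (0 : ℝ)..t, 1 / Real.sqrt (G s))
    Filter.atTop Filter.atTop
  γ_contMDiff : ContMDiff 𝓘(ℝ, Eu n) 𝓘(ℝ, ℝ) 2 γ
  γ_nonneg : ∀ x, 0 ≤ γ x
  γ_tendsto : Filter.Tendsto γ (Filter.cocompact M) Filter.atTop
  gradient_le : ∃ A : ℝ, 0 < A ∧ ∃ K : Set M, IsCompact K ∧ ∀ x ∉ K,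
    vecNorm g (gradient g γ x) ≤ A * Real.sqrt (G (γ x)) * growth G (γ x)
  laplacian_le : ∃ B : ℝ, 0 < B ∧ ∃ K : Set M, IsCompact K ∧ ∀ x ∉ K,
    laplacian g γ x ≤ B * Real.sqrt (G (γ x)) * growth G (γ x)

end OmoriYau

end

/-! Along an isometric immersion the height satisfies `Δh = (ξ'/ξ)(h) (n - |∇h|²) + n ⟨H, ∂ₜ⟩`
(`laplacian_height`). If `sup |H| < s < i < inf ξ'/ξ`, then `|∇h|² ≤ 1 ≤ n` and `⟨H, ∂ₜ⟩ ≥ -|H|`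
give `Δh ≥ n (i - s) - i |∇h|²`. This is impossible at a point where both `|∇h|` and `Δh` are small
from above.

Such points come from an Omori–Yau principle for functions that may be unbounded
(`IsOmoriYauPair.exists_gradient_le_laplacian_le`). Since `h = o(ψ(γ))`, the function `h - ε ψ(γ)`
has a maximum at some `x`. As `ψ` is concave, it may be replaced there by its tangent: `h - ε
ψ'(γ(x)) γ` is also maximal at `x`. Hence `∇h = ε ψ'(γ(x)) ∇γ` and `Δh ≤ ε ψ'(γ(x)) Δγ`, and the
bounds on `γ` are exactly `A / ψ'(γ)` and `B / ψ'(γ)`. They hold only off a compact set; if the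
maxima cannot be pushed out of it, `h` itself has a maximum, which serves even better. -/

namespace OmoriYau

/-! ### Linear algebra: inverse metrics and traces. -/

/-- A positive definite bilinear form on a finite dimensional space is invertible. -/
theorem isInvertible_of_posDef {E : Type*} [NormedAddCommGroup E] [NormedSpace ℝ E]
    [FiniteDimensional ℝ E] (b : E →L[ℝ] E →L[ℝ] ℝ) (hb : ∀ v, v ≠ 0 → 0 < b v v) :
    b.IsInvertible := by
  have hinj : Function.Injective (b : E →ₗ[ℝ] E →L[ℝ] ℝ) := by
    rw [injective_iff_map_eq_zero]
    intro v hv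
    by_contra h
    have h1 := hb v h
    have h2 : b v = 0 := hv
    rw [h2] at h1
    exact lt_irrefl _ h1
  have hfin : Module.finrank ℝ E = Module.finrank ℝ (E →L[ℝ] ℝ) := by
    rw [← LinearEquiv.finrank_eq
      (LinearMap.toContinuousLinearMap : (E →ₗ[ℝ] ℝ) ≃ₗ[ℝ] (E →L[ℝ] ℝ))]
    exact (Subspace.dual_finrank_eq (K := ℝ) (V := E)).symm
  refine ⟨(LinearEquiv.ofInjectiveOfFinrankEq _ hinj hfin).toContinuousLinearEquiv, ?_⟩
  ext v w
  rfl

theorem apply_inverse_of_posDef {E : Type*} [NormedAddCommGroup E] [NormedSpace ℝ E]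
    [FiniteDimensional ℝ E] (b : E →L[ℝ] E →L[ℝ] ℝ) (hb : ∀ v, v ≠ 0 → 0 < b v v)
    (l : E →L[ℝ] ℝ) : b (b.inverse l) = l := by
  obtain ⟨e, he⟩ := isInvertible_of_posDef b hb
  rw [← he, ContinuousLinearMap.inverse_equiv]
  exact e.apply_symm_apply l

section Trace

variable {n : ℕ} {g : Eu n →L[ℝ] Eu n →L[ℝ] ℝ}

theorem sum_apply_single_smul_proj (l : Eu n →L[ℝ] ℝ) :
    ∑ i, l (EuclideanSpace.single i 1) • (EuclideanSpace.proj i : Eu n →L[ℝ] ℝ) = l := by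
  ext v
  conv_rhs => rw [← (EuclideanSpace.basisFun (Fin n) ℝ).sum_repr v]
  simp [mul_comm]

/-- The trace of a rank one form `l ⊗ l` is the squared norm of the vector dual to `l`. -/
theorem metricTrace_rankOne (hpos : ∀ v, v ≠ 0 → 0 < g v v) (l : Eu n →L[ℝ] ℝ) :
    metricTrace g (fun v w ↦ l v * l w) = g (g.inverse l) (g.inverse l) := by
  rw [apply_inverse_of_posDef g hpos]
  have h : g.inverse l
      = ∑ i, l (EuclideanSpace.single i 1) • g.inverse (EuclideanSpace.proj i) := by
    conv_lhs => rw [← sum_apply_single_smul_proj l]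
    simp only [map_sum, map_smul]
  rw [h]
  simp only [metricTrace, map_sum, map_smul, smul_eq_mul]

theorem metricTrace_self (hpos : ∀ v, v ≠ 0 → 0 < g v v) (hsymm : ∀ v w, g v w = g w v) :
    metricTrace g (fun v w ↦ g v w) = n := by
  have h (i : Fin n) : g (EuclideanSpace.single i 1) (g.inverse (EuclideanSpace.proj i)) = 1 := by
    rw [hsymm, apply_inverse_of_posDef g hpos]
    simp
  simp [metricTrace, h]

open scoped MatrixOrder Matrix.Norms.L2Operator in
/-- The trace of a bilinear form is a sum of values of its quadratic form. -/
theorem exists_metricTrace_eq_sum (hpos : ∀ v, v ≠ 0 → 0 < g v v)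
    (hsymm : ∀ v w, g v w = g w v) :
    ∃ w : Fin n → Eu n, ∀ B : Eu n →L[ℝ] Eu n →L[ℝ] ℝ,
      metricTrace g (fun v w ↦ B v w) = ∑ k, B (w k) (w k) := by
  set f : Fin n → Eu n := fun i ↦ g.inverse (EuclideanSpace.proj i) with hf
  have hgf (i : Fin n) (v : Eu n) : g (f i) v = v i := by
    rw [hf, apply_inverse_of_posDef g hpos]; rfl
  -- `A` is the inverse matrix `gⁱʲ`. A factorization `A = Sᵀ S` takes the place of an orthonormal
  -- basis: the rows of `S` are the vectors `w k`.
  let A : Matrix (Fin n) (Fin n) ℝ := Matrix.of fun i j ↦ f i j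
  have hA : A.PosSemidef := by
    refine Matrix.PosSemidef.of_dotProduct_mulVec_nonneg ?_ ?_
    · ext i j
      simp only [A, Matrix.conjTranspose_apply, Matrix.of_apply, star_trivial]
      rw [← hgf, ← hgf, hsymm]
    · intro x
      have : star x ⬝ᵥ A.mulVec x = g (∑ i, x i • f i) (∑ i, x i • f i) := by
        simp only [map_sum, sum_apply, map_smul,
          smul_apply, hgf, dotProduct, Matrix.mulVec, A, Matrix.of_apply,
          smul_eq_mul, Finset.mul_sum, star_trivial]
        rw [Finset.sum_comm]
        simp only [← hgf]
        refine Finset.sum_congr rfl fun i _ ↦ Finset.sum_congr rfl fun j _ ↦ ?_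
        rw [hsymm]; ring
      rw [this]
      by_cases h : (∑ i, x i • f i) = 0
      · simp [h]
      · exact (hpos _ h).le
  obtain ⟨S, hS⟩ := CStarAlgebra.nonneg_iff_eq_star_mul_self.mp hA.nonneg
  have hfj (i : Fin n) : f i = ∑ k, S k i • ∑ j, S k j • EuclideanSpace.single j (1 : ℝ) := by
    ext j
    have h : f i j = (star S * S) i j := by rw [← hS]; rfl
    rw [h, Matrix.mul_apply]
    simp [Matrix.star_apply, Pi.single_apply]
  refine ⟨fun k ↦ ∑ i, S k i • EuclideanSpace.single i 1, fun B ↦ ?_⟩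
  calc metricTrace g (fun v w ↦ B v w) = ∑ i, B (EuclideanSpace.single i 1) (f i) := rfl
    _ = ∑ i, ∑ k, S k i • B (EuclideanSpace.single i 1)
          (∑ j, S k j • EuclideanSpace.single j (1 : ℝ)) := by
        refine Finset.sum_congr rfl fun i _ ↦ ?_
        conv_lhs => rw [hfj]
        rw [map_sum]
        exact Finset.sum_congr rfl fun k _ ↦ map_smul _ _ _
    _ = _ := by
        rw [Finset.sum_comm]
        refine Finset.sum_congr rfl fun k _ ↦ ?_
        have h (z : Eu n) : B (∑ i, S k i • EuclideanSpace.single i (1 : ℝ)) z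
            = ∑ i, S k i • B (EuclideanSpace.single i 1) z := by
          rw [map_sum, sum_apply]
          exact Finset.sum_congr rfl fun i _ ↦ by rw [map_smul, smul_apply]
        exact (h _).symm

end Trace

/-! ### Calculus: the second derivative test and the concavity of `ψ`. -/

/-- The second derivative test: at a local maximum the second derivative is nonpositive. -/
theorem fderiv_fderiv_apply_self_nonpos {E : Type*} [NormedAddCommGroup E] [NormedSpace ℝ E]
    {f : E → ℝ} {u : E} (hf : ContDiffAt ℝ 2 f u) (hmax : IsLocalMax f u) (w : E) :
    fderiv ℝ (fderiv ℝ f) u w w ≤ 0 := by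
  let c : ℝ → E := fun t ↦ u + t • w
  have hc0 : c 0 = u := by simp [c]
  have hc (t : ℝ) : HasDerivAt c w t := by
    simpa [c] using ((hasDerivAt_id t).smul_const w).const_add u
  have hcc : Filter.Tendsto c (𝓝 0) (𝓝 u) := by
    simpa [hc0] using (hc 0).continuousAt.tendsto
  have hev : ∀ᶠ x in 𝓝 u, DifferentiableAt ℝ f x :=
    (hf.eventually (by simp)).mono fun x hx ↦ hx.differentiableAt (by simp)
  have h1 : deriv (f ∘ c) =ᶠ[𝓝 0] fun t ↦ fderiv ℝ f (c t) w := by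
    filter_upwards [hcc.eventually hev] with t ht
    exact (ht.hasFDerivAt.comp_hasDerivAt t (hc t)).deriv
  have h2 : HasFDerivAt (fderiv ℝ f) (fderiv ℝ (fderiv ℝ f) u) u :=
    ((hf.fderiv_right (m := 1) (by norm_num)).differentiableAt (by simp)).hasFDerivAt
  have h3 : deriv (deriv (f ∘ c)) 0 = fderiv ℝ (fderiv ℝ f) u w w := by
    rw [h1.deriv_eq]
    have h4 : HasDerivAt (fun t ↦ fderiv ℝ f (c t)) (fderiv ℝ (fderiv ℝ f) u w) 0 := by
      have h5 : HasFDerivAt (fderiv ℝ f) (fderiv ℝ (fderiv ℝ f) u) (c 0) := by rwa [hc0]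
      exact h5.comp_hasDerivAt 0 (hc 0)
    simpa using (h4.clm_apply (hasDerivAt_const 0 w)).deriv
  have hmax' : IsLocalMax (f ∘ c) 0 := by
    have : IsLocalMax f (c 0) := by rwa [hc0]
    exact this.comp_continuous (hc 0).continuousAt
  have hd : deriv (f ∘ c) 0 = 0 := hmax'.deriv_eq_zero
  rw [← h3]
  by_contra! hcon
  have hcont : ContinuousAt (f ∘ c) 0 :=
    ContinuousAt.comp (by rw [hc0]; exact hf.continuousAt) (hc 0).continuousAt
  -- A positive second derivative along the line makes `0` a local minimum as well, so the
  -- restriction is locally constant and its second derivative vanishes.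
  have hmin := isLocalMin_of_deriv_deriv_pos hcon hd hcont
  have hconst : f ∘ c =ᶠ[𝓝 0] fun _ ↦ (f ∘ c) 0 := by
    filter_upwards [hmin, hmax'] with t h h' using le_antisymm h' h
  have : deriv (deriv (f ∘ c)) 0 = 0 := by
    rw [hconst.deriv.deriv_eq]; simp
  exact hcon.ne' this

section Growth

variable {G : ℝ → ℝ}

theorem intervalIntegrable_one_div_sqrt (hG : ContinuousOn G (Set.Ici 0))
    (hpos : ∀ t, 0 ≤ t → 0 < G t) {s t : ℝ} (hs : 0 ≤ s) (ht : 0 ≤ t) :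
    IntervalIntegrable (fun r ↦ 1 / √(G r)) MeasureTheory.volume s t := by
  have hsub : Set.uIcc s t ⊆ Set.Ici 0 := fun r hr ↦ (le_inf hs ht).trans hr.1
  refine ContinuousOn.intervalIntegrable ?_
  refine continuousOn_const.div ((hG.mono hsub).sqrt) fun r hr ↦ ?_
  exact (Real.sqrt_pos.mpr (hpos r (hsub hr))).ne'

theorem one_le_growth (G : ℝ → ℝ) {t : ℝ} (ht : 0 ≤ t) : 1 ≤ growth G t := by
  have : 0 ≤ ∫ s in (0 : ℝ)..t, 1 / √(G s) :=
    intervalIntegral.integral_nonneg ht fun r _ ↦ by positivity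
  simpa [growth] using this

/-- The function `psi` lies below its tangents. -/
theorem psi_sub_psi_le (hG : ContinuousOn G (Set.Ici 0)) (hpos : ∀ t, 0 ≤ t → 0 < G t)
    (hmono : MonotoneOn G (Set.Ici 0)) {s t : ℝ} (hs : 0 ≤ s) (ht : 0 ≤ t) :
    psi G t - psi G s ≤ (√(G s) * growth G s)⁻¹ * (t - s) := by
  have hgs := one_le_growth G hs
  have hgt := one_le_growth G ht
  have hsq : 0 < √(G s) := Real.sqrt_pos.mpr (hpos s hs)
  have hint : growth G t - growth G s = ∫ r in s..t, 1 / √(G r) := by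
    have := intervalIntegral.integral_interval_sub_left
      (intervalIntegrable_one_div_sqrt hG hpos le_rfl ht)
      (intervalIntegrable_one_div_sqrt hG hpos le_rfl hs)
    rw [← this]; simp [growth]
  -- `growth G` is concave because `1 / √G` is nonincreasing; the two orders of `s` and `t` compare
  -- the integrand with its value at `s` from opposite sides.
  have hle : growth G t - growth G s ≤ (√(G s))⁻¹ * (t - s) := by
    rw [hint]
    rcases le_total s t with hst | hst
    · calc ∫ r in s..t, 1 / √(G r) ≤ ∫ _ in s..t, (√(G s))⁻¹ := by
            refine intervalIntegral.integral_mono_on hst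
              (intervalIntegrable_one_div_sqrt hG hpos hs ht) (by simp) fun r hr ↦ ?_
            rw [one_div]
            exact inv_anti₀ hsq (Real.sqrt_le_sqrt (hmono hs (hs.trans hr.1) hr.1))
        _ = (√(G s))⁻¹ * (t - s) := by simp [mul_comm]
    · rw [intervalIntegral.integral_symm]
      have : ∫ _ in t..s, (√(G s))⁻¹ ≤ ∫ r in t..s, 1 / √(G r) := by
        refine intervalIntegral.integral_mono_on hst (by simp)
          (intervalIntegrable_one_div_sqrt hG hpos ht hs) fun r hr ↦ ?_
        rw [one_div]
        have hr0 : 0 ≤ r := ht.trans hr.1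
        exact inv_anti₀ (Real.sqrt_pos.mpr (hpos r hr0)) (Real.sqrt_le_sqrt (hmono hr0 hs hr.2))
      rw [intervalIntegral.integral_const, smul_eq_mul] at this
      linarith
  have hgs0 : 0 < growth G s := by linarith
  have hgt0 : 0 < growth G t := by linarith
  calc psi G t - psi G s = Real.log (growth G t / growth G s) := by
        rw [Real.log_div hgt0.ne' hgs0.ne', psi, psi]
    -- Concavity of the logarithm.
    _ ≤ growth G t / growth G s - 1 := Real.log_le_sub_one_of_pos (by positivity)
    _ = (growth G s)⁻¹ * (growth G t - growth G s) := by field_simp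
    _ ≤ (growth G s)⁻¹ * ((√(G s))⁻¹ * (t - s)) := by gcongr
    _ = (√(G s) * growth G s)⁻¹ * (t - s) := by rw [mul_inv]; ring

theorem psi_nonneg (G : ℝ → ℝ) {t : ℝ} (ht : 0 ≤ t) : 0 ≤ psi G t :=
  Real.log_nonneg (one_le_growth G ht)

theorem tendsto_psi (hint : Filter.Tendsto (fun t : ℝ ↦ ∫ s in (0 : ℝ)..t, 1 / √(G s))
    Filter.atTop Filter.atTop) : Filter.Tendsto (psi G) Filter.atTop Filter.atTop :=
  Real.tendsto_log_atTop.comp (Filter.tendsto_atTop_add_const_right _ 1 hint)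

end Growth

/-! ### Metrics in the preferred charts. -/

section Metric

variable {n : ℕ} {X : Type*} [TopologicalSpace X] [ChartedSpace (Eu n) X]
  [IsManifold 𝓘(ℝ, Eu n) ∞ X]

theorem mdifferentiableAt_extChartAt_symm_of_mem_target {x : X} {u : Eu n}
    (hu : u ∈ (extChartAt 𝓘(ℝ, Eu n) x).target) :
    MDifferentiableAt 𝓘(ℝ, Eu n) 𝓘(ℝ, Eu n) (extChartAt 𝓘(ℝ, Eu n) x).symm u := by
  have : IsManifold 𝓘(ℝ, Eu n) 1 X := .of_le (n := ∞) (by simp)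
  have h := mdifferentiableWithinAt_extChartAt_symm (I := 𝓘(ℝ, Eu n)) hu
  rwa [ModelWithCorners.range_eq_univ, mdifferentiableWithinAt_univ] at h

theorem mfderiv_extChartAt_symm_self {E : Type*} [NormedAddCommGroup E] [NormedSpace ℝ E]
    {X : Type*} [TopologicalSpace X] [ChartedSpace E X] [IsManifold 𝓘(ℝ, E) ∞ X] (x : X) (v : E) :
    (mfderiv 𝓘(ℝ, E) 𝓘(ℝ, E) (extChartAt 𝓘(ℝ, E) x).symm (extChartAt 𝓘(ℝ, E) x x) v : E) = v := by
  have : IsManifold 𝓘(ℝ, E) 1 X := .of_le (n := ∞) (by simp)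
  have h := mfderivWithin_range_extChartAt_symm (I := 𝓘(ℝ, E)) (x := x)
  rw [ModelWithCorners.range_eq_univ, mfderivWithin_univ] at h
  exact DFunLike.congr_fun h v

/-- The base point and the image vectors are free variables so that they can be substituted
together, as the tangent space depends on the point. -/
theorem inChart_apply_eq {E H : Type*} [NormedAddCommGroup E] [NormedSpace ℝ E]
    [TopologicalSpace H] {I : ModelWithCorners ℝ E H} {X : Type*} [TopologicalSpace X]
    [ChartedSpace H X] (g : BilinField I X) {x p : X} {u v w a b : E}
    (hp : (extChartAt I x).symm u = p)
    (ha : mfderiv 𝓘(ℝ, E) I (extChartAt I x).symm u v = a)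
    (hb : mfderiv 𝓘(ℝ, E) I (extChartAt I x).symm u w = b) :
    inChart g x u v w = (g p : E →L[ℝ] E →L[ℝ] ℝ) a b := by
  subst hp ha hb
  rfl

/-- In the preferred chart, a metric has its own coefficients at the base point. -/
theorem inChart_apply_self {E : Type*} [NormedAddCommGroup E] [NormedSpace ℝ E]
    {X : Type*} [TopologicalSpace X] [ChartedSpace E X] [IsManifold 𝓘(ℝ, E) ∞ X]
    (g : BilinField 𝓘(ℝ, E) X) (x : X) (v w : E) :
    inChart g x (extChartAt 𝓘(ℝ, E) x x) v w = (g x : E →L[ℝ] E →L[ℝ] ℝ) v w :=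
  inChart_apply_eq g (extChartAt_to_inv x) (mfderiv_extChartAt_symm_self x v)
    (mfderiv_extChartAt_symm_self x w)

/-- Smoothness of a metric is defined through bundle trivializations. On the tangent bundle these
are the derivatives of the charts, so smoothness passes to the coefficients used in `christoffel`.
-/
theorem inChart_eq_inCoordinates (g : BilinField 𝓘(ℝ, Eu n) X) (x : X) {p : X}
    (hp : p ∈ (chartAt (Eu n) x).source) :
    inChart g x (extChartAt 𝓘(ℝ, Eu n) x p)
      = ContinuousLinearMap.inCoordinates (Eu n) (TangentSpace 𝓘(ℝ, Eu n)) (Eu n →L[ℝ] ℝ)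
        (fun x : X ↦ TangentSpace 𝓘(ℝ, Eu n) x →L[ℝ] ℝ) x p x p (g p) := by
  have : IsManifold 𝓘(ℝ, Eu n) 1 X := .of_le (n := ∞) (by simp)
  have hb : p ∈ (trivializationAt (Eu n) (TangentSpace 𝓘(ℝ, Eu n)) x).baseSet := by
    simpa using hp
  have hs := TangentBundle.symmL_trivializationAt (I := 𝓘(ℝ, Eu n)) hp
  rw [ModelWithCorners.range_eq_univ, mfderivWithin_univ] at hs
  ext v w
  have h := inCoordinates_apply_eq₂ (𝕜 := ℝ) (F₁ := Eu n) (F₂ := Eu n)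
    (F₃ := ℝ) (E₁ := fun x : X ↦ TangentSpace 𝓘(ℝ, Eu n) x)
    (E₂ := fun x : X ↦ TangentSpace 𝓘(ℝ, Eu n) x) (E₃ := Bundle.Trivial X ℝ)
    (ϕ := g p) (v := v) (w := w) hb hb (Set.mem_univ _)
  refine Eq.trans ?_ h.symm
  have e (v : Eu n) : (trivializationAt (Eu n) (TangentSpace 𝓘(ℝ, Eu n)) x).symm p v
      = mfderiv 𝓘(ℝ, Eu n) 𝓘(ℝ, Eu n) (extChartAt 𝓘(ℝ, Eu n) x).symm
        (extChartAt 𝓘(ℝ, Eu n) x p) v := by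
    rw [← hs]
    exact (Trivialization.symmL_apply _ hb _).symm
  rw [inChart_apply_eq g ((extChartAt 𝓘(ℝ, Eu n) x).left_inv (by simpa using hp))
    (e v).symm (e w).symm]
  simp only [Trivial.fiberBundle_trivializationAt', Trivial.linearMapAt_trivialization]
  rfl

theorem differentiableAt_inChart (g : RMetric n X) (x : X) :
    DifferentiableAt ℝ (inChart g.inner x) (extChartAt 𝓘(ℝ, Eu n) x x) := by
  have : IsManifold 𝓘(ℝ, Eu n) 1 X := .of_le (n := ∞) (by simp)
  have h1 := ((contMDiffAt_hom_bundle _).mp (g.contMDiff x)).2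
  have h1' := h1.mdifferentiableAt (by simp)
  have h2 : MDifferentiableAt 𝓘(ℝ, Eu n) 𝓘(ℝ, Eu n) (extChartAt 𝓘(ℝ, Eu n) x).symm
      (extChartAt 𝓘(ℝ, Eu n) x x) :=
    mdifferentiableAt_extChartAt_symm_of_mem_target (mem_extChartAt_target x)
  have h3 := MDifferentiableAt.comp_of_eq _ h1' h2 (extChartAt_to_inv x)
  refine (h3.differentiableAt).congr_of_eventuallyEq ?_
  filter_upwards [extChartAt_target_mem_nhds (I := 𝓘(ℝ, Eu n)) x] with u hu
  have h4 := inChart_eq_inCoordinates g.inner x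
    (p := (extChartAt 𝓘(ℝ, Eu n) x).symm u) (by simpa using (extChartAt 𝓘(ℝ, Eu n) x).map_target hu)
  rw [(extChartAt 𝓘(ℝ, Eu n) x).right_inv hu] at h4
  exact h4

end Metric

/-! ### The warped product metric and its Christoffel symbols. -/

section Warped

variable {n : ℕ} {P : Type*} [TopologicalSpace P] [ChartedSpace (Eu n) P]
  [IsManifold 𝓘(ℝ, Eu n) ∞ P]

omit [IsManifold 𝓘(ℝ, Eu n) ∞ P] in
theorem warpedMetric_apply (ξ : ℝ → ℝ) (g : BilinField 𝓘(ℝ, Eu n) P) (y : ℝ × P) (v w : ℝ × Eu n) :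
    (warpedMetric ξ g y v w : ℝ)
      = v.1 * w.1 + ξ y.1 ^ 2 * (g y.2 : Eu n →L[ℝ] Eu n →L[ℝ] ℝ) v.2 w.2 := rfl

theorem mfderiv_extChartAt_prod_symm (y : ℝ × P) {u : ℝ × Eu n}
    (hu : u.2 ∈ (extChartAt 𝓘(ℝ, Eu n) y.2).target) (v : ℝ × Eu n) :
    (mfderiv 𝓘(ℝ, ℝ × Eu n) (𝓘(ℝ, ℝ).prod 𝓘(ℝ, Eu n))
        (extChartAt (𝓘(ℝ, ℝ).prod 𝓘(ℝ, Eu n)) y).symm u v : ℝ × Eu n)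
      = (v.1, mfderiv 𝓘(ℝ, Eu n) 𝓘(ℝ, Eu n) (extChartAt 𝓘(ℝ, Eu n) y.2).symm u.2 v.2) := by
  have : IsManifold 𝓘(ℝ, Eu n) 1 P := .of_le (n := ∞) (by simp)
  have hs : MDifferentiableAt 𝓘(ℝ, Eu n) 𝓘(ℝ, Eu n) (extChartAt 𝓘(ℝ, Eu n) y.2).symm u.2 :=
    mdifferentiableAt_extChartAt_symm_of_mem_target hu
  have h1 : HasMFDerivAt 𝓘(ℝ, ℝ × Eu n) 𝓘(ℝ, ℝ) (Prod.fst : ℝ × Eu n → ℝ) u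
      (ContinuousLinearMap.fst ℝ ℝ (Eu n)) := hasFDerivAt_fst.hasMFDerivAt
  have h2 : HasMFDerivAt 𝓘(ℝ, ℝ × Eu n) 𝓘(ℝ, Eu n) (Prod.snd : ℝ × Eu n → Eu n) u
      (ContinuousLinearMap.snd ℝ ℝ (Eu n)) := hasFDerivAt_snd.hasMFDerivAt
  have h3 := h1.prodMk (hs.hasMFDerivAt.comp u h2)
  have h4 : ((extChartAt (𝓘(ℝ, ℝ).prod 𝓘(ℝ, Eu n)) y).symm : ℝ × Eu n → ℝ × P)
      = fun z ↦ (z.1, ((extChartAt 𝓘(ℝ, Eu n) y.2).symm ∘ Prod.snd) z) := by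
    rw [extChartAt_prod]
    rfl
  rw [h4, h3.mfderiv]
  rfl

theorem inChart_warpedMetric_apply (ξ : ℝ → ℝ) (g : BilinField 𝓘(ℝ, Eu n) P) (y : ℝ × P)
    {u : ℝ × Eu n} (hu : u.2 ∈ (extChartAt 𝓘(ℝ, Eu n) y.2).target) (v w : ℝ × Eu n) :
    inChart (warpedMetric ξ g) y u v w
      = v.1 * w.1 + ξ u.1 ^ 2 * inChart g y.2 u.2 v.2 w.2 := by
  have hp : (extChartAt (𝓘(ℝ, ℝ).prod 𝓘(ℝ, Eu n)) y).symm u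
      = (u.1, (extChartAt 𝓘(ℝ, Eu n) y.2).symm u.2) := by
    rw [extChartAt_prod]
    rfl
  rw [inChart_apply_eq (warpedMetric ξ g) hp (mfderiv_extChartAt_prod_symm y hu v)
    (mfderiv_extChartAt_prod_symm y hu w)]
  rfl

end Warped

/-- The first component of the Christoffel symbols of a metric of the form `dt² + ξ(t)² k`. -/
theorem fst_christoffel_of_warped {E : Type*} [NormedAddCommGroup E] [NormedSpace ℝ E]
    [FiniteDimensional ℝ E] {G : ℝ × E → ℝ × E →L[ℝ] ℝ × E →L[ℝ] ℝ}
    {k : E → E →L[ℝ] E →L[ℝ] ℝ} {ξ : ℝ → ℝ} {u : ℝ × E} (hG : DifferentiableAt ℝ G u)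
    (hξ : DifferentiableAt ℝ ξ u.1) (hpos : ∀ v, v ≠ 0 → 0 < G u v v)
    (hev : ∀ᶠ p in 𝓝 u, ∀ v w, G p v w = v.1 * w.1 + ξ p.1 ^ 2 * k p.2 v.2 w.2) (v w : ℝ × E) :
    (christoffel G u v w).1 = -(ξ u.1 * deriv ξ u.1 * k u.2 v.2 w.2) := by
  have happly (v w z : ℝ × E) :
      HasFDerivAt (fun p ↦ G p w z) (((fderiv ℝ G u).flip w).flip z) u := by
    have h := (hG.hasFDerivAt.clm_apply (hasFDerivAt_const w u)).clm_apply (hasFDerivAt_const z u)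
    refine h.congr_fderiv ?_
    ext v <;> simp
  -- The coefficients paired with `∂ₜ = (1, 0)` are constant, so of the three terms of the
  -- Christoffel symbol only the `t`-derivative of `ξ² k` survives.
  have h1 (v w : ℝ × E) : fderiv ℝ G u v w (1, 0) = 0 := by
    have he : (fun p ↦ G p w (1, 0)) =ᶠ[𝓝 u] fun _ ↦ w.1 := by
      filter_upwards [hev] with p hp
      simp [hp]
    have h := (happly v w (1, 0)).fderiv
    rw [he.fderiv_eq] at h
    simpa using (DFunLike.congr_fun h v).symm
  have h2 : fderiv ℝ G u (1, 0) v w = 2 * ξ u.1 * deriv ξ u.1 * k u.2 v.2 w.2 := by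
    have hc : HasDerivAt (fun t : ℝ ↦ (t, u.2)) (1, 0) u.1 :=
      (hasDerivAt_id u.1).prodMk (hasDerivAt_const _ _)
    have hcomp := HasFDerivAt.comp_hasDerivAt (f := fun t : ℝ ↦ (t, u.2)) u.1 (happly v v w) hc
    have he : ((fun p ↦ G p v w) ∘ fun t : ℝ ↦ (t, u.2)) =ᶠ[𝓝 u.1]
        fun t ↦ v.1 * w.1 + ξ t ^ 2 * k u.2 v.2 w.2 := by
      filter_upwards [hc.continuousAt.tendsto.eventually hev] with t ht
      exact ht v w
    have h3 := ((hξ.hasDerivAt.pow 2).mul_const (k u.2 v.2 w.2)).const_add (v.1 * w.1)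
    have h4 := (hcomp.congr_of_eventuallyEq he.symm).unique h3
    simpa using h4
  -- `∂ₜ` is a unit vector orthogonal to the fibre, so pairing with it reads off the first
  -- component.
  have h5 : (christoffel G u v w).1 = G u (christoffel G u v w) (1, 0) := by
    simp [hev.self_of_nhds]
  rw [h5, christoffel, apply_inverse_of_posDef (G u) hpos]
  simp only [smul_apply, sub_apply, add_apply, ContinuousLinearMap.flip_apply, h1, h2, smul_eq_mul]
  ring

theorem differentiableAt_sq_smul_linearMap {E V W : Type*} [NormedAddCommGroup E]
    [NormedSpace ℝ E] [NormedAddCommGroup V] [NormedSpace ℝ V] [FiniteDimensional ℝ V]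
    [NormedAddCommGroup W] [NormedSpace ℝ W] {k : E → V} {ξ : ℝ → ℝ} {u : ℝ × E} (Φ : V →ₗ[ℝ] W)
    (hξ : DifferentiableAt ℝ ξ u.1) (hk : DifferentiableAt ℝ k u.2) :
    DifferentiableAt ℝ (fun p : ℝ × E ↦ ξ p.1 ^ 2 • Φ (k p.2)) u := by
  have hk' : DifferentiableAt ℝ (fun p : ℝ × E ↦ k p.2) u := hk.comp u differentiableAt_snd
  have hΦ : DifferentiableAt ℝ (fun p : ℝ × E ↦ Φ (k p.2)) u :=
    Φ.toContinuousLinearMap.differentiableAt.comp u hk'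
  exact ((hξ.comp u differentiableAt_fst).pow 2).smul hΦ

/-- The pullback of bilinear forms under the projection `ℝ × E → E`. -/
noncomputable def pullSnd (E : Type*) [NormedAddCommGroup E] [NormedSpace ℝ E] :
    (E →L[ℝ] E →L[ℝ] ℝ) →ₗ[ℝ] (ℝ × E →L[ℝ] ℝ × E →L[ℝ] ℝ) where
  toFun B := B.bilinearComp (.snd ℝ ℝ E) (.snd ℝ ℝ E)
  map_add' _ _ := rfl
  map_smul' _ _ := rfl

set_option synthInstance.maxHeartbeats 200000 in
theorem differentiableAt_warped {E : Type*} [NormedAddCommGroup E] [NormedSpace ℝ E]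
    [FiniteDimensional ℝ E] {k : E → E →L[ℝ] E →L[ℝ] ℝ} {ξ : ℝ → ℝ} {u : ℝ × E}
    (hξ : DifferentiableAt ℝ ξ u.1) (hk : DifferentiableAt ℝ k u.2) :
    DifferentiableAt ℝ (fun p : ℝ × E ↦
      (ContinuousLinearMap.mul ℝ ℝ).bilinearComp (.fst ℝ ℝ E) (.fst ℝ ℝ E)
        + ξ p.1 ^ 2 • (k p.2).bilinearComp (.snd ℝ ℝ E) (.snd ℝ ℝ E)) u := by
  have h := differentiableAt_sq_smul_linearMap (V := E →L[ℝ] E →L[ℝ] ℝ)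
    (W := ℝ × E →L[ℝ] ℝ × E →L[ℝ] ℝ) (pullSnd E) hξ hk
  exact h.const_add _

section Warped

variable {n : ℕ} {P : Type*} [TopologicalSpace P] [ChartedSpace (Eu n) P]
  [IsManifold 𝓘(ℝ, Eu n) ∞ P]

omit [IsManifold 𝓘(ℝ, Eu n) ∞ P] in
theorem extChartAt_prod_self (y : ℝ × P) :
    extChartAt (𝓘(ℝ, ℝ).prod 𝓘(ℝ, Eu n)) y y = (y.1, extChartAt 𝓘(ℝ, Eu n) y.2 y.2) := by
  rw [extChartAt_prod]
  rfl

theorem eventually_inChart_warpedMetric_apply (ξ : ℝ → ℝ) (g : BilinField 𝓘(ℝ, Eu n) P)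
    (y : ℝ × P) :
    ∀ᶠ u in 𝓝 ((y.1, extChartAt 𝓘(ℝ, Eu n) y.2 y.2) : ℝ × Eu n), ∀ v w : ℝ × Eu n,
      inChart (warpedMetric ξ g) y u v w = v.1 * w.1 + ξ u.1 ^ 2 * inChart g y.2 u.2 v.2 w.2 := by
  have h : ∀ᶠ u in 𝓝 ((y.1, extChartAt 𝓘(ℝ, Eu n) y.2 y.2) : ℝ × Eu n),
      u.2 ∈ (extChartAt 𝓘(ℝ, Eu n) y.2).target :=
    continuousAt_snd.tendsto.eventually (extChartAt_target_mem_nhds (I := 𝓘(ℝ, Eu n)) y.2)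
  filter_upwards [h] with u hu v w
  exact inChart_warpedMetric_apply ξ g y hu v w

theorem differentiableAt_inChart_warpedMetric {ξ : ℝ → ℝ} (g : RMetric n P) (y : ℝ × P)
    (hξ : DifferentiableAt ℝ ξ y.1) :
    DifferentiableAt ℝ (inChart (warpedMetric ξ g.inner) y)
      ((y.1, extChartAt 𝓘(ℝ, Eu n) y.2 y.2) : ℝ × Eu n) := by
  refine (differentiableAt_warped (u := ((y.1, extChartAt 𝓘(ℝ, Eu n) y.2 y.2) : ℝ × Eu n)) hξ
    (differentiableAt_inChart g y.2)).congr_of_eventuallyEq ?_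
  filter_upwards [eventually_inChart_warpedMetric_apply ξ g.inner y] with u hu
  refine ContinuousLinearMap.ext fun v ↦ ContinuousLinearMap.ext fun w ↦ ?_
  rw [hu v w]
  rfl

theorem RMetric.inner_self_nonneg (g : RMetric n P) (p : P) (v : Eu n) :
    0 ≤ (g.inner p : Eu n →L[ℝ] Eu n →L[ℝ] ℝ) v v := by
  by_cases h : v = 0
  · subst h
    exact (map_zero ((g.inner p : Eu n →L[ℝ] Eu n →L[ℝ] ℝ) 0)).ge
  · exact (g.pos p v h).le

theorem warpedMetric_pos {ξ : ℝ → ℝ} (g : RMetric n P) {y : ℝ × P} (hξ : 0 < ξ y.1) {v : ℝ × Eu n}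
    (hv : v ≠ 0) : (0 : ℝ) < warpedMetric ξ g.inner y v v := by
  rw [warpedMetric_apply]
  by_cases h2 : v.2 = 0
  · have h1 : v.1 ≠ 0 := fun h1 ↦ hv (Prod.ext h1 h2)
    exact add_pos_of_pos_of_nonneg (mul_self_pos.mpr h1)
      (mul_nonneg (sq_nonneg _) (g.inner_self_nonneg y.2 v.2))
  · have : (0 : ℝ) < (g.inner y.2 : Eu n →L[ℝ] Eu n →L[ℝ] ℝ) v.2 v.2 := g.pos y.2 v.2 h2
    nlinarith [mul_self_nonneg v.1, mul_pos (pow_pos hξ 2) this]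

theorem fst_christoffel_inChart_warpedMetric {ξ : ℝ → ℝ} (g : RMetric n P) (y : ℝ × P)
    (hξ : DifferentiableAt ℝ ξ y.1) (hpos : 0 < ξ y.1) (v w : ℝ × Eu n) :
    (christoffel (inChart (warpedMetric ξ g.inner) y)
        (extChartAt (𝓘(ℝ, ℝ).prod 𝓘(ℝ, Eu n)) y y) v w : ℝ × Eu n).1
      = -(ξ y.1 * deriv ξ y.1 * (g.inner y.2 : Eu n →L[ℝ] Eu n →L[ℝ] ℝ) v.2 w.2) := by
  rw [extChartAt_prod_self]
  rw [fst_christoffel_of_warped (k := inChart g.inner y.2) (ξ := ξ)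
    (differentiableAt_inChart_warpedMetric g y hξ) hξ ?_
    (eventually_inChart_warpedMetric_apply ξ g.inner y), inChart_apply_self]
  intro v hv
  rw [inChart_warpedMetric_apply ξ g.inner y (mem_extChartAt_target _), inChart_apply_self]
  exact warpedMetric_pos g hpos hv

/-- The length of the `t`-component of a vector is at most the length of the vector. -/
theorem abs_fst_le_vecNorm_warpedMetric {ξ : ℝ → ℝ} (g : RMetric n P) {y : ℝ × P}
    (v : TangentSpace (𝓘(ℝ, ℝ).prod 𝓘(ℝ, Eu n)) y) :
    |(show ℝ × Eu n from v).1| ≤ vecNorm (warpedMetric ξ g.inner) v := by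
  refine Real.abs_le_sqrt ?_
  let v' : ℝ × Eu n := v
  have h := RMetric.inner_self_nonneg g y.2 v'.2
  change v'.1 ^ 2 ≤ v'.1 * v'.1 + ξ y.1 ^ 2 * (g.inner y.2 : Eu n →L[ℝ] Eu n →L[ℝ] ℝ) v'.2 v'.2
  nlinarith [mul_nonneg (sq_nonneg (ξ y.1)) h]

end Warped

/-! ### First and second order conditions at a maximum of `f - c γ`. -/

section Hypersurface

variable {n : ℕ} {M : Type*} [TopologicalSpace M] [ChartedSpace (Eu n) M]
  [IsManifold 𝓘(ℝ, Eu n) ∞ M]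

omit [IsManifold 𝓘(ℝ, Eu n) ∞ M] in
theorem contDiffAt_comp_extChartAt_symm {f : M → ℝ} {m : WithTop ℕ∞}
    (hf : ContMDiff 𝓘(ℝ, Eu n) 𝓘(ℝ, ℝ) m f) (x : M) :
    ContDiffAt ℝ m (f ∘ (extChartAt 𝓘(ℝ, Eu n) x).symm) (extChartAt 𝓘(ℝ, Eu n) x x) := by
  have h := (contMDiffAt_iff.mp (hf x)).2
  rw [ModelWithCorners.range_eq_univ, contDiffWithinAt_univ] at h
  exact h

omit [IsManifold 𝓘(ℝ, Eu n) ∞ M] in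
theorem mfderiv_eq_fderiv_comp_extChartAt_symm {f : M → ℝ} {x : M}
    (hf : MDifferentiableAt 𝓘(ℝ, Eu n) 𝓘(ℝ, ℝ) f x) :
    (mfderiv 𝓘(ℝ, Eu n) 𝓘(ℝ, ℝ) f x : Eu n →L[ℝ] ℝ)
      = fderiv ℝ (f ∘ (extChartAt 𝓘(ℝ, Eu n) x).symm) (extChartAt 𝓘(ℝ, Eu n) x x) := by
  rw [hf.mfderiv, ModelWithCorners.range_eq_univ, fderivWithin_univ]
  rfl

omit [IsManifold 𝓘(ℝ, Eu n) ∞ M] in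
theorem isLocalMax_comp_extChartAt_symm {f : M → ℝ} {x : M} (hmax : IsLocalMax f x) :
    IsLocalMax (f ∘ (extChartAt 𝓘(ℝ, Eu n) x).symm) (extChartAt 𝓘(ℝ, Eu n) x x) := by
  have h : IsLocalMax f ((extChartAt 𝓘(ℝ, Eu n) x).symm (extChartAt 𝓘(ℝ, Eu n) x x)) := by
    rwa [extChartAt_to_inv]
  exact h.comp_continuous (continuousAt_extChartAt_symm x)

omit [IsManifold 𝓘(ℝ, Eu n) ∞ M] in
theorem fderiv_eq_smul_of_isLocalMax_sub {f γ : M → ℝ} {c : ℝ} {x : M}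
    (hf : ContMDiff 𝓘(ℝ, Eu n) 𝓘(ℝ, ℝ) 2 f) (hγ : ContMDiff 𝓘(ℝ, Eu n) 𝓘(ℝ, ℝ) 2 γ)
    (hmax : IsLocalMax (fun y ↦ f y - c * γ y) x) :
    fderiv ℝ (f ∘ (extChartAt 𝓘(ℝ, Eu n) x).symm) (extChartAt 𝓘(ℝ, Eu n) x x)
      = c • fderiv ℝ (γ ∘ (extChartAt 𝓘(ℝ, Eu n) x).symm) (extChartAt 𝓘(ℝ, Eu n) x x) := by
  have h1 := ((contDiffAt_comp_extChartAt_symm hf x).differentiableAt (by simp)).hasFDerivAt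
  have h2 := ((contDiffAt_comp_extChartAt_symm hγ x).differentiableAt (by simp)).hasFDerivAt
  have h3 := (isLocalMax_comp_extChartAt_symm hmax).hasFDerivAt_eq_zero
    (h1.sub (h2.const_mul c))
  exact sub_eq_zero.mp h3

omit [IsManifold 𝓘(ℝ, Eu n) ∞ M] in
/-- At a local maximum of `f - c γ` the gradient of `f` is `c` times that of `γ`. -/
theorem gradient_eq_smul_of_isLocalMax_sub (g : BilinField 𝓘(ℝ, Eu n) M) {f γ : M → ℝ} {c : ℝ}
    {x : M} (hf : ContMDiff 𝓘(ℝ, Eu n) 𝓘(ℝ, ℝ) 2 f) (hγ : ContMDiff 𝓘(ℝ, Eu n) 𝓘(ℝ, ℝ) 2 γ)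
    (hmax : IsLocalMax (fun y ↦ f y - c * γ y) x) :
    gradient g f x = c • gradient g γ x := by
  have h1 := mfderiv_eq_fderiv_comp_extChartAt_symm (hf.mdifferentiableAt (by simp) (x := x))
  have h2 := mfderiv_eq_fderiv_comp_extChartAt_symm (hγ.mdifferentiableAt (by simp) (x := x))
  have h3 := fderiv_eq_smul_of_isLocalMax_sub hf hγ hmax
  rw [← h1, ← h2] at h3
  let b : Eu n →L[ℝ] Eu n →L[ℝ] ℝ := g x
  exact (congrArg b.inverse h3).trans (map_smul b.inverse c _)

/-- At a local maximum of `f - c γ`, the Laplacian of `f` is at most `c` times that of `γ`. -/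
theorem laplacian_le_of_isLocalMax_sub (g : RMetric n M) {f γ : M → ℝ} {c : ℝ} {x : M}
    (hf : ContMDiff 𝓘(ℝ, Eu n) 𝓘(ℝ, ℝ) 2 f) (hγ : ContMDiff 𝓘(ℝ, Eu n) 𝓘(ℝ, ℝ) 2 γ)
    (hmax : IsLocalMax (fun y ↦ f y - c * γ y) x) :
    laplacian g.inner f x ≤ c * laplacian g.inner γ x := by
  set u : Eu n := extChartAt 𝓘(ℝ, Eu n) x x with hu
  set f' : Eu n → ℝ := f ∘ (extChartAt 𝓘(ℝ, Eu n) x).symm with hf'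
  set γ' : Eu n → ℝ := γ ∘ (extChartAt 𝓘(ℝ, Eu n) x).symm with hγ'
  have hcf : ContDiffAt ℝ 2 f' u := contDiffAt_comp_extChartAt_symm hf x
  have hcγ : ContDiffAt ℝ 2 γ' u := contDiffAt_comp_extChartAt_symm hγ x
  have hd : fderiv ℝ f' u = c • fderiv ℝ γ' u := fderiv_eq_smul_of_isLocalMax_sub hf hγ hmax
  have hmax' : IsLocalMax (fun z ↦ f' z - c * γ' z) u := isLocalMax_comp_extChartAt_symm hmax
  let B : Eu n →L[ℝ] Eu n →L[ℝ] ℝ := fderiv ℝ (fderiv ℝ (fun z ↦ f' z - c * γ' z)) u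
  have hev (F : Eu n → ℝ) (hF : ContDiffAt ℝ 2 F u) : ∀ᶠ z in 𝓝 u, DifferentiableAt ℝ F z :=
    (hF.eventually (by simp)).mono fun z hz ↦ hz.differentiableAt (by simp)
  have hfd (F : Eu n → ℝ) (hF : ContDiffAt ℝ 2 F u) : DifferentiableAt ℝ (fderiv ℝ F) u :=
    (hF.fderiv_right (m := 1) (by norm_num)).differentiableAt (by simp)
  have hB : B = fderiv ℝ (fderiv ℝ f') u - c • fderiv ℝ (fderiv ℝ γ') u := by
    have he : fderiv ℝ (fun z ↦ f' z - c * γ' z) =ᶠ[𝓝 u]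
        fun z ↦ fderiv ℝ f' z - c • fderiv ℝ γ' z := by
      filter_upwards [hev f' hcf, hev γ' hcγ] with z h1 h2
      exact (h1.hasFDerivAt.sub (h2.hasFDerivAt.const_mul c)).fderiv
    exact he.fderiv_eq.trans
      ((hfd f' hcf).hasFDerivAt.sub ((hfd γ' hcγ).hasFDerivAt.const_smul c)).fderiv
  -- The Christoffel terms cancel because `df = c dγ` at `x`: at a critical point the Hessian is the
  -- plain second derivative.
  have hhess (v w : Eu n) : hessian g.inner f x v w - c * hessian g.inner γ x v w = B v w := by
    simp only [hessian, ← hu, ← hf', ← hγ', hd, hB, sub_apply, smul_apply, smul_eq_mul]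
    ring
  obtain ⟨e, he⟩ := exists_metricTrace_eq_sum (g := (g.inner x : Eu n →L[ℝ] Eu n →L[ℝ] ℝ))
    (g.pos x) (g.symm x)
  have htr : metricTrace (g.inner x : Eu n →L[ℝ] Eu n →L[ℝ] ℝ) (fun v w ↦ B v w) ≤ 0 := by
    rw [he]
    exact Finset.sum_nonpos fun k _ ↦
      fderiv_fderiv_apply_self_nonpos (hcf.sub (contDiffAt_const.mul hcγ)) hmax' (e k)
  have hsub : laplacian g.inner f x - c * laplacian g.inner γ x
      = metricTrace (g.inner x : Eu n →L[ℝ] Eu n →L[ℝ] ℝ) (fun v w ↦ B v w) := by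
    simp only [laplacian, metricTrace, Finset.mul_sum, ← hhess, Finset.sum_sub_distrib]
  linarith

end Hypersurface

/-! ### The gradient and the Laplacian of the height function. -/

section Gauss

variable {n : ℕ} {P : Type*} [TopologicalSpace P] [ChartedSpace (Eu n) P]
  [IsManifold 𝓘(ℝ, Eu n) ∞ P] {M : Type*} [TopologicalSpace M] [ChartedSpace (Eu n) M]
  [IsManifold 𝓘(ℝ, Eu n) ∞ M] {φ : M → ℝ × P} {ξ : ℝ → ℝ} {gM : RMetric n M} {gP : RMetric n P}

omit [IsManifold 𝓘(ℝ, Eu n) ∞ P] [IsManifold 𝓘(ℝ, Eu n) ∞ M] in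
theorem contMDiff_height (hφ : ContMDiff 𝓘(ℝ, Eu n) (𝓘(ℝ, ℝ).prod 𝓘(ℝ, Eu n)) ∞ φ) :
    ContMDiff 𝓘(ℝ, Eu n) 𝓘(ℝ, ℝ) ∞ fun x ↦ (φ x).1 :=
  contMDiff_fst.comp hφ

/-- The `t`-component of the second fundamental form of an immersion into a warped product. -/
theorem fst_secondFundamentalForm
    (hφ : IsIsometricImmersion gM.inner (warpedMetric ξ gP.inner) φ) {x : M}
    (hξ : DifferentiableAt ℝ ξ (φ x).1) (hpos : 0 < ξ (φ x).1) (v w : Eu n) :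
    let dh : Eu n →L[ℝ] ℝ := mfderiv 𝓘(ℝ, Eu n) 𝓘(ℝ, ℝ) (fun y ↦ (φ y).1) x
    (secondFundamentalForm gM.inner (warpedMetric ξ gP.inner) φ x v w).1
      = hessian gM.inner (fun y ↦ (φ y).1) x v w - deriv ξ (φ x).1 / ξ (φ x).1 *
        ((gM.inner x : Eu n →L[ℝ] Eu n →L[ℝ] ℝ) v w
          - dh v * dh w) := by
  intro dh
  set u : Eu n := extChartAt 𝓘(ℝ, Eu n) x x with hu
  set φ' : Eu n → ℝ × Eu n :=
    writtenInExtChartAt 𝓘(ℝ, Eu n) (𝓘(ℝ, ℝ).prod 𝓘(ℝ, Eu n)) x φ with hφ'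
  set h' : Eu n → ℝ := (fun y ↦ (φ y).1) ∘ (extChartAt 𝓘(ℝ, Eu n) x).symm with hh'
  have hsm : ContDiffAt ℝ ∞ φ' u := by
    have h := (contMDiffAt_iff.mp (hφ.1 x)).2
    rw [ModelWithCorners.range_eq_univ, contDiffWithinAt_univ] at h
    exact h
  have hfst : h' = fun z ↦ (φ' z).1 := by
    rw [hφ', hh']
    funext z
    simp only [writtenInExtChartAt, extChartAt_prod]
    rfl
  have hev : ∀ᶠ z in 𝓝 u, DifferentiableAt ℝ φ' z :=
    ((hsm.of_le (m := 1) (by simp)).eventually (by simp)).mono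
      fun z hz ↦ hz.differentiableAt (by simp)
  have hd : fderiv ℝ h' =ᶠ[𝓝 u] 
      fun z ↦ (ContinuousLinearMap.fst ℝ ℝ (Eu n)).comp (fderiv ℝ φ' z) := by
    filter_upwards [hev] with z hz
    rw [hfst]
    exact hz.hasFDerivAt.fst.fderiv
  have hd2 : DifferentiableAt ℝ (fderiv ℝ φ') u :=
    (hsm.fderiv_right (m := 1) (by norm_cast)).differentiableAt (by simp)
  have h1 (v : Eu n) : fderiv ℝ h' u v = (fderiv ℝ φ' u v).1 := by
    rw [hd.self_of_nhds]; rfl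
  have h2 (v w : Eu n) : fderiv ℝ (fderiv ℝ h') u v w = (fderiv ℝ (fderiv ℝ φ') u v w).1 := by
    rw [hd.fderiv_eq]
    have h := (hasFDerivAt_const (ContinuousLinearMap.fst ℝ ℝ (Eu n)) u).clm_comp hd2.hasFDerivAt
    rw [h.fderiv]
    simp
  have hdh : dh = fderiv ℝ h' u :=
    mfderiv_eq_fderiv_comp_extChartAt_symm
      ((contMDiff_height hφ.1).mdifferentiableAt (by simp))
  have hdφ : (mfderiv 𝓘(ℝ, Eu n) (𝓘(ℝ, ℝ).prod 𝓘(ℝ, Eu n)) φ x : Eu n →L[ℝ] (ℝ × Eu n))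
      = fderiv ℝ φ' u := by
    rw [(hφ.1.mdifferentiableAt (by simp)).mfderiv, ModelWithCorners.range_eq_univ,
      fderivWithin_univ]
  -- The isometry condition turns `ξ² g_P(dφ v, dφ w)` into `g_M(v, w) - dh(v) dh(w)`, which
  -- eliminates the fibre metric from the Christoffel term.
  have hiso : (fderiv ℝ φ' u v).1 * (fderiv ℝ φ' u w).1 + ξ (φ x).1 ^ 2 *
      (gP.inner (φ x).2 : Eu n →L[ℝ] Eu n →L[ℝ] ℝ) (fderiv ℝ φ' u v).2 (fderiv ℝ φ' u w).2
      = (gM.inner x : Eu n →L[ℝ] Eu n →L[ℝ] ℝ) v w := by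
    rw [← hdφ]
    exact hφ.2 x v w
  have hφu : φ' u = extChartAt (𝓘(ℝ, ℝ).prod 𝓘(ℝ, Eu n)) (φ x) (φ x) := by
    rw [hφ', hu, writtenInExtChartAt, Function.comp_apply, Function.comp_apply, extChartAt_to_inv]
  have hchr := fst_christoffel_inChart_warpedMetric gP (φ x) hξ hpos
    (fderiv ℝ φ' u v) (fderiv ℝ φ' u w)
  rw [← hφu] at hchr
  rw [hdh, h1, h1, ← hiso]
  simp only [secondFundamentalForm, hessian, ← hu, ← hφ', ← hh', Prod.fst_add, Prod.fst_sub, h1, h2]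
  refine (congrArg (fun r : ℝ ↦ _ + r) hchr).trans ?_
  field_simp
  ring

/-- The Laplacian of the height function of a hypersurface of a warped product. -/
theorem laplacian_height (hφ : IsIsometricImmersion gM.inner (warpedMetric ξ gP.inner) φ) {x : M}
    (hn : 1 ≤ n) (hξ : DifferentiableAt ℝ ξ (φ x).1) (hpos : 0 < ξ (φ x).1) :
    laplacian gM.inner (fun y ↦ (φ y).1) x
      = deriv ξ (φ x).1 / ξ (φ x).1 *
          (n - vecNorm gM.inner (gradient gM.inner (fun y ↦ (φ y).1) x) ^ 2)
        + n * (show ℝ × Eu n from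
            meanCurvature gM.inner (warpedMetric ξ gP.inner) φ x).1 := by
  let dh : Eu n →L[ℝ] ℝ := mfderiv 𝓘(ℝ, Eu n) 𝓘(ℝ, ℝ) (fun y ↦ (φ y).1) x
  let g : Eu n →L[ℝ] Eu n →L[ℝ] ℝ := gM.inner x
  have hn0 : (n : ℝ) ≠ 0 := by positivity
  have htr : (n : ℝ) * (show ℝ × Eu n from
      meanCurvature gM.inner (warpedMetric ξ gP.inner) φ x).1
      = metricTrace g (fun v w ↦
        (secondFundamentalForm gM.inner (warpedMetric ξ gP.inner) φ x v w).1) := by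
    change (n : ℝ) * ((n : ℝ)⁻¹ • (metricTrace g
      (secondFundamentalForm gM.inner (warpedMetric ξ gP.inner) φ x) : ℝ × Eu n)).1 = _
    rw [Prod.smul_fst, smul_eq_mul, mul_inv_cancel_left₀ hn0, metricTrace, Prod.fst_sum]
    rfl
  have hlap : metricTrace g (fun v w ↦
        (secondFundamentalForm gM.inner (warpedMetric ξ gP.inner) φ x v w).1)
      = laplacian gM.inner (fun y ↦ (φ y).1) x - deriv ξ (φ x).1 / ξ (φ x).1 *
        (metricTrace g (fun v w ↦ g v w) - metricTrace g (fun v w ↦ dh v * dh w)) := by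
    simp only [laplacian, metricTrace, ← Finset.sum_sub_distrib, Finset.mul_sum]
    exact Finset.sum_congr rfl fun i _ ↦ fst_secondFundamentalForm hφ hξ hpos _ _
  rw [metricTrace_self (gM.pos x) (gM.symm x), metricTrace_rankOne (gM.pos x)] at hlap
  have hnorm : vecNorm gM.inner (gradient gM.inner (fun y ↦ (φ y).1) x) ^ 2
      = g (g.inverse dh) (g.inverse dh) :=
    Real.sq_sqrt (gM.inner_self_nonneg x _)
  rw [hnorm, htr, hlap]
  ring

/-- The gradient of the height function of a hypersurface of a warped product has length at most
`1`. -/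
theorem vecNorm_gradient_height_sq_le_one
    (hφ : IsIsometricImmersion gM.inner (warpedMetric ξ gP.inner) φ) (x : M) :
    vecNorm gM.inner (gradient gM.inner (fun y ↦ (φ y).1) x) ^ 2 ≤ 1 := by
  let dh : Eu n →L[ℝ] ℝ := mfderiv 𝓘(ℝ, Eu n) 𝓘(ℝ, ℝ) (fun y ↦ (φ y).1) x
  let dφ : Eu n →L[ℝ] (ℝ × Eu n) := mfderiv 𝓘(ℝ, Eu n) (𝓘(ℝ, ℝ).prod 𝓘(ℝ, Eu n)) φ x
  let g : Eu n →L[ℝ] Eu n →L[ℝ] ℝ := gM.inner x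
  have hfst (v : Eu n) : dh v = (dφ v).1 := by
    have h := mfderiv_comp (f := φ) (g := (Prod.fst : ℝ × P → ℝ)) (I'' := 𝓘(ℝ, ℝ)) x
      mdifferentiableAt_fst (hφ.1.mdifferentiableAt (by simp))
    rw [mfderiv_fst] at h
    exact DFunLike.congr_fun h v
  have hle (v : Eu n) : dh v ^ 2 ≤ g v v := by
    have h : warpedMetric ξ gP.inner (φ x) (dφ v) (dφ v) = g v v := hφ.2 x v v
    rw [warpedMetric_apply] at h
    rw [← h, hfst]
    have := mul_nonneg (sq_nonneg (ξ (φ x).1)) (gP.inner_self_nonneg (φ x).2 (dφ v).2)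
    linarith [sq (dφ v).1]
  have hnorm : vecNorm gM.inner (gradient gM.inner (fun y ↦ (φ y).1) x) ^ 2
      = g (g.inverse dh) (g.inverse dh) :=
    Real.sq_sqrt (gM.inner_self_nonneg x _)
  -- With `v = ∇h` the inequality reads `|∇h|⁴ ≤ |∇h|²`.
  have h := hle (g.inverse dh)
  rw [hnorm]
  rw [apply_inverse_of_posDef g (gM.pos x)] at h ⊢
  nlinarith

end Gauss

/-! ### Maxima of `h - ε p` when `h = o(p)`. -/

section Maximum

open Filter

variable {M : Type*} [TopologicalSpace M] [Nonempty M] {h p : M → ℝ}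

theorem exists_isMax_sub_mul (hh : Continuous h) (hp : Continuous p)
    (hpt : Tendsto p (cocompact M) atTop)
    (hdiv : Tendsto (fun x ↦ h x / p x) (cocompact M) (𝓝 0)) {ε : ℝ} (hε : 0 < ε) :
    ∃ x, ∀ y, h y - ε * p y ≤ h x - ε * p x := by
  obtain ⟨x₀⟩ := ‹Nonempty M›
  have hc : Continuous fun x ↦ h x - ε * p x := hh.sub (continuous_const.mul hp)
  refine hc.exists_forall_ge' x₀ ?_
  -- Far out `h ≤ (ε/2) p`, hence `h - ε p ≤ -(ε/2) p`, which falls below the value at `x₀` once `p`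
  -- is large.
  filter_upwards [hdiv.eventually (gt_mem_nhds (half_pos hε)), hpt.eventually_gt_atTop 0,
    hpt.eventually_ge_atTop (-(h x₀ - ε * p x₀) / (ε / 2))] with x h1 h2 h3
  rw [div_lt_iff₀ h2] at h1
  rw [div_le_iff₀ (half_pos hε)] at h3
  linarith

/-- If `h` grows more slowly than `p` at infinity, then either `h` has a maximum, or the maxima of
`h - ε p` leave a given compact set as `ε → 0`. -/
theorem exists_isMax_or_exists_isMax_sub_mul (hh : Continuous h) (hp : Continuous p)
    (hp0 : ∀ x, 0 ≤ p x) (hpt : Tendsto p (cocompact M) atTop)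
    (hdiv : Tendsto (fun x ↦ h x / p x) (cocompact M) (𝓝 0)) {K : Set M} (hK : IsCompact K)
    {δ : ℝ} (hδ : 0 < δ) :
    (∃ x, ∀ y, h y ≤ h x) ∨
      ∃ ε, 0 < ε ∧ ε ≤ δ ∧ ∃ x ∉ K, ∀ y, h y - ε * p y ≤ h x - ε * p x := by
  rcases K.eq_empty_or_nonempty with rfl | hne
  · obtain ⟨x, hx⟩ := exists_isMax_sub_mul hh hp hpt hdiv hδ
    exact .inr ⟨δ, hδ, le_rfl, x, Set.notMem_empty x, hx⟩
  obtain ⟨z, -, hz⟩ := hK.exists_isMaxOn hne hh.continuousOn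
  by_cases hmax : ∀ y, h y ≤ h z
  · exact .inl ⟨z, hmax⟩
  push Not at hmax
  obtain ⟨y, hy⟩ := hmax
  -- For `ε p(y) < h(y) - max_K h`, the point `y` still beats every point of `K`, since `p ≥ 0`
  -- there.
  obtain ⟨ε, hε, hεp⟩ := exists_pos_mul_lt (sub_pos.mpr hy) (p y)
  obtain ⟨x, hx⟩ := exists_isMax_sub_mul hh hp hpt hdiv (lt_min hε hδ)
  refine .inr ⟨min ε δ, lt_min hε hδ, min_le_right _ _, x, fun hxK ↦ ?_, hx⟩
  have h1 : h x ≤ h z := hz hxK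
  have h2 : min ε δ * p y ≤ ε * p y := mul_le_mul_of_nonneg_right (min_le_left _ _) (hp0 y)
  have h3 : 0 ≤ min ε δ * p x := mul_nonneg (lt_min hε hδ).le (hp0 x)
  linarith [hx y]

end Maximum

/-! ### The Omori–Yau principle for functions of slow growth. -/

theorem continuousOn_psi {G : ℝ → ℝ} (hG : ContinuousOn G (Set.Ici 0))
    (hpos : ∀ t, 0 ≤ t → 0 < G t) (hmono : MonotoneOn G (Set.Ici 0)) :
    ContinuousOn (psi G) (Set.Ici 0) := by
  -- The slope of `ψ` is largest at `0`, where it equals `1 / √(G 0)`, so this is a Lipschitz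
  -- constant.
  refine (LipschitzOnWith.of_le_add_mul' (√(G 0))⁻¹ fun t ht s hs ↦ ?_).continuousOn
  have h := psi_sub_psi_le hG hpos hmono hs ht
  have h0 : 0 < √(G 0) := Real.sqrt_pos.mpr (hpos 0 le_rfl)
  have hle : √(G 0) ≤ √(G s) * growth G s :=
    (Real.sqrt_le_sqrt (hmono Set.self_mem_Ici hs hs)).trans
      (le_mul_of_one_le_right (Real.sqrt_nonneg _) (one_le_growth G hs))
  have h1 : (√(G s) * growth G s)⁻¹ ≤ (√(G 0))⁻¹ := inv_anti₀ h0 hle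
  have h2 : (√(G s) * growth G s)⁻¹ * (t - s) ≤ (√(G 0))⁻¹ * dist t s := by
    have : t - s ≤ dist t s := le_abs_self _
    have h3 : 0 ≤ (√(G s) * growth G s)⁻¹ := inv_nonneg.mpr (h0.le.trans hle)
    exact (mul_le_mul_of_nonneg_left this h3).trans (mul_le_mul_of_nonneg_right h1 dist_nonneg)
  linarith

theorem IsOmoriYauPair.monotoneOn {n : ℕ} {M : Type*} [TopologicalSpace M] [ChartedSpace (Eu n) M]
    {g : BilinField 𝓘(ℝ, Eu n) M} {G : ℝ → ℝ} {γ : M → ℝ} (h : IsOmoriYauPair g G γ) :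
    MonotoneOn G (Set.Ici 0) := by
  refine monotoneOn_of_deriv_nonneg (convex_Ici 0) h.G_contDiff.continuousOn
    ((h.G_contDiff.differentiableOn (by simp)).mono interior_subset) fun t ht ↦ ?_
  rw [← derivWithin_of_mem_nhds (mem_interior_iff_mem_nhds.mp ht)]
  exact h.G_deriv_nonneg t (interior_subset ht)

section OmoriYauPrinciple

variable {n : ℕ} {M : Type*} [TopologicalSpace M] [ChartedSpace (Eu n) M]
  [IsManifold 𝓘(ℝ, Eu n) ∞ M]

theorem vecNorm_smul (g : RMetric n M) {x : M} {c : ℝ} (hc : 0 ≤ c)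
    (v : TangentSpace 𝓘(ℝ, Eu n) x) : vecNorm g.inner (c • v) = c * vecNorm g.inner v := by
  let b : Eu n →L[ℝ] Eu n →L[ℝ] ℝ := g.inner x
  have hb (w : Eu n) : b (c • w) (c • w) = c ^ 2 * b w w := by
    simp only [map_smul, smul_apply, smul_eq_mul]
    ring
  have h : g.inner x (c • v) (c • v) = c ^ 2 * g.inner x v v := hb v
  rw [vecNorm, h, Real.sqrt_mul (sq_nonneg c), Real.sqrt_sq hc]
  rfl

/-- The Omori-Yau maximum principle for functions of slow growth, which may be unbounded: at
suitable points the gradient and the Laplacian are almost nonpositive. -/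
theorem IsOmoriYauPair.exists_gradient_le_laplacian_le [Nonempty M] {g : RMetric n M} {G : ℝ → ℝ}
    {γ h : M → ℝ} (hpair : IsOmoriYauPair g.inner G γ) (hh : ContMDiff 𝓘(ℝ, Eu n) 𝓘(ℝ, ℝ) 2 h)
    (hgrowth : Filter.Tendsto (fun x ↦ h x / psi G (γ x)) (Filter.cocompact M) (𝓝 0)) :
    ∃ C : ℝ, 0 < C ∧ ∀ δ : ℝ, 0 < δ → ∃ x,
      vecNorm g.inner (gradient g.inner h x) ≤ δ * C ∧ laplacian g.inner h x ≤ δ * C := by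
  obtain ⟨A, hA, K₁, hK₁, hgrad⟩ := hpair.gradient_le
  obtain ⟨B, hB, K₂, hK₂, hlap⟩ := hpair.laplacian_le
  have hG := hpair.G_contDiff.continuousOn
  have hmono := hpair.monotoneOn
  have hcont : Continuous fun x ↦ psi G (γ x) :=
    (continuousOn_psi hG hpair.G_pos hmono).comp_continuous hpair.γ_contMDiff.continuous
      hpair.γ_nonneg
  refine ⟨A + B, by positivity, fun δ hδ ↦ ?_⟩
  rcases exists_isMax_or_exists_isMax_sub_mul hh.continuous hcont
    (fun x ↦ psi_nonneg G (hpair.γ_nonneg x))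
    ((tendsto_psi hpair.G_integral).comp hpair.γ_tendsto) hgrowth (hK₁.union hK₂) hδ with
    ⟨x, hx⟩ | ⟨ε, hε, hεδ, x, hxK, hx⟩
  -- A maximum of `h` itself is the case `c = 0` of the comparison with `γ`.
  · have hmax : IsLocalMax (fun y ↦ h y - 0 * γ y) x :=
      Filter.Eventually.of_forall fun y ↦ by simpa using hx y
    have h1 := laplacian_le_of_isLocalMax_sub g hh hpair.γ_contMDiff hmax
    have h2 := gradient_eq_smul_of_isLocalMax_sub g.inner hh hpair.γ_contMDiff hmax
    have h3 := vecNorm_smul g le_rfl (gradient g.inner γ x)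
    have h4 : 0 ≤ δ * (A + B) := by positivity
    refine ⟨x, ?_, ?_⟩
    · rw [h2, h3, zero_mul]; exact h4
    · rw [zero_mul] at h1; exact h1.trans h4
  · rw [Set.mem_union, not_or] at hxK
    -- `s⁻¹` is the slope of `ψ` at `γ x`; replacing `ψ` by its tangent there keeps the maximum at
    -- `x`.
    set s : ℝ := √(G (γ x)) * growth G (γ x) with hs
    have hs0 : 0 < s := mul_pos (Real.sqrt_pos.mpr (hpair.G_pos _ (hpair.γ_nonneg x)))
      (zero_lt_one.trans_le (one_le_growth G (hpair.γ_nonneg x)))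
    have hmax : IsLocalMax (fun y ↦ h y - ε * s⁻¹ * γ y) x := by
      refine Filter.Eventually.of_forall fun y ↦ ?_
      have h1 := psi_sub_psi_le hG hpair.G_pos hmono (hpair.γ_nonneg x) (hpair.γ_nonneg y)
      have h2 := mul_le_mul_of_nonneg_left h1 hε.le
      have h3 := hx y
      simp only [← hs] at h2
      linarith
    have hc : 0 ≤ ε * s⁻¹ := by positivity
    have h1 := laplacian_le_of_isLocalMax_sub g hh hpair.γ_contMDiff hmax
    have h2 := gradient_eq_smul_of_isLocalMax_sub g.inner hh hpair.γ_contMDiff hmax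
    have hg := mul_le_mul_of_nonneg_left (hgrad x hxK.1) hc
    have hl := mul_le_mul_of_nonneg_left (hlap x hxK.2) hc
    have e (D : ℝ) : ε * s⁻¹ * (D * √(G (γ x)) * growth G (γ x)) = ε * D := by
      rw [mul_assoc D, ← hs]; field_simp
    rw [e] at hg hl
    have hεA : ε * A ≤ δ * (A + B) := by gcongr; linarith
    have hεB : ε * B ≤ δ * (A + B) := by gcongr; linarith
    refine ⟨x, ?_, h1.trans (hl.trans hεB)⟩
    rw [h2, vecNorm_smul g hc]
    exact hg.trans hεA

end OmoriYauPrinciple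

end OmoriYau

/-! ### The mean curvature estimate. -/

theorem theorem4p8 {n : ℕ} (hn : 1 ≤ n)
    -- the fibre `Pⁿ`
    {P : Type*} [TopologicalSpace P] [T2Space P] [ChartedSpace (OmoriYau.Eu n) P]
    [IsManifold 𝓘(ℝ, OmoriYau.Eu n) ∞ P] (gP : OmoriYau.RMetric n P)
    -- the open interval and the warping function
    (I : Set ℝ) (hI_open : IsOpen I) (hI_interval : I.OrdConnected)
    (ξ : ℝ → ℝ) (hξ : ContDiffOn ℝ ∞ ξ I) (hξ_pos : ∀ t ∈ I, 0 < ξ t)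
    -- the hypersurface `Mⁿ` of `I ×_ξ Pⁿ`
    {M : Type*} [TopologicalSpace M] [T2Space M] [Nonempty M] [ChartedSpace (OmoriYau.Eu n) M]
    [IsManifold 𝓘(ℝ, OmoriYau.Eu n) ∞ M] (gM : OmoriYau.RMetric n M)
    (φ : M → ℝ × P) (hφ_mem : ∀ x, (φ x).1 ∈ I)
    (hφ : OmoriYau.IsIsometricImmersion gM.inner (OmoriYau.warpedMetric ξ gP.inner) φ)
    -- the Omori-Yau pair and the growth of the height function
    (G : ℝ → ℝ) (γ : M → ℝ) (hpair : OmoriYau.IsOmoriYauPair gM.inner G γ)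
    (hheight : Filter.Tendsto (fun x ↦ (φ x).1 / OmoriYau.psi G (γ x))
      (Filter.cocompact M) (𝓝 0)) :
    (⨅ x : M, ((deriv ξ (φ x).1 / ξ (φ x).1 : ℝ) : EReal)) ≤
      ⨆ x : M, ((OmoriYau.vecNorm (OmoriYau.warpedMetric ξ gP.inner)
        (OmoriYau.meanCurvature gM.inner (OmoriYau.warpedMetric ξ gP.inner) φ x) : ℝ) :
          EReal) := by
  by_contra! hlt
  obtain ⟨s, hs, hlt'⟩ := EReal.lt_iff_exists_real_btwn.mp hlt
  obtain ⟨i, hi, hi'⟩ := EReal.lt_iff_exists_real_btwn.mp hlt'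
  have hsi : s < i := EReal.coe_lt_coe_iff.mp hi
  have hH (x : M) : OmoriYau.vecNorm (OmoriYau.warpedMetric ξ gP.inner)
      (OmoriYau.meanCurvature gM.inner (OmoriYau.warpedMetric ξ gP.inner) φ x) ≤ s :=
    EReal.coe_le_coe_iff.mp ((le_iSup (fun x : M ↦ ((OmoriYau.vecNorm
      (OmoriYau.warpedMetric ξ gP.inner) (OmoriYau.meanCurvature gM.inner
        (OmoriYau.warpedMetric ξ gP.inner) φ x) : ℝ) : EReal)) x).trans hs.le)
  have hξi (x : M) : i ≤ deriv ξ (φ x).1 / ξ (φ x).1 :=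
    EReal.coe_le_coe_iff.mp (hi'.le.trans
      (iInf_le (fun x : M ↦ ((deriv ξ (φ x).1 / ξ (φ x).1 : ℝ) : EReal)) x))
  -- This makes `i` positive, which is needed to bound `i * N ^ 2` from above.
  have hs0 : 0 ≤ s := (Real.sqrt_nonneg _).trans (hH (Classical.arbitrary M))
  have hn0 : (1 : ℝ) ≤ n := by exact_mod_cast hn
  obtain ⟨C, hC, hOY⟩ := hpair.exists_gradient_le_laplacian_le
    ((OmoriYau.contMDiff_height hφ.1).of_le ENat.LEInfty.out) hheight
  -- With `δ = min ε 1`, the estimates at `x` give `n (i - s) ≤ δ C + i δ C²`, contrary to this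
  -- choice of `ε`. The cap at `1` allows `δ² ≤ δ`.
  obtain ⟨ε, hε, hεlt⟩ := exists_pos_mul_lt (mul_pos (zero_lt_one.trans_le hn0) (sub_pos.mpr hsi))
    (C + i * C ^ 2)
  obtain ⟨x, hgrad, hlap⟩ := hOY (min ε 1) (lt_min hε one_pos)
  have hδ0 : 0 < min ε 1 := lt_min hε one_pos
  have hx := hφ_mem x
  have hξx : DifferentiableAt ℝ ξ (φ x).1 :=
    (hξ.contDiffAt (hI_open.mem_nhds hx)).differentiableAt (by simp)
  rw [OmoriYau.laplacian_height hφ hn hξx (hξ_pos _ hx)] at hlap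
  have hfst := neg_le_of_abs_le (OmoriYau.abs_fst_le_vecNorm_warpedMetric (ξ := ξ) gP
    (OmoriYau.meanCurvature gM.inner (OmoriYau.warpedMetric ξ gP.inner) φ x))
  have hg1 := OmoriYau.vecNorm_gradient_height_sq_le_one hφ x
  set N := OmoriYau.vecNorm gM.inner (OmoriYau.gradient gM.inner (fun y ↦ (φ y).1) x)
  have hN0 : 0 ≤ N := Real.sqrt_nonneg _
  have hN2 : N ^ 2 ≤ min ε 1 * C ^ 2 := calc
    N ^ 2 ≤ (min ε 1 * C) ^ 2 := by gcongr
    _ = min ε 1 * (min ε 1 * C ^ 2) := by ring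
    _ ≤ 1 * (min ε 1 * C ^ 2) := by gcongr; exact min_le_right _ _
    _ = _ := one_mul _
  -- The factor `n - N ^ 2` is nonnegative because `N ^ 2 ≤ 1 ≤ n`.
  have h1 : i * (n - N ^ 2) ≤ deriv ξ (φ x).1 / ξ (φ x).1 * (n - N ^ 2) :=
    mul_le_mul_of_nonneg_right (hξi x) (by linarith)
  have h2 := mul_le_mul_of_nonneg_left hfst (zero_le_one.trans hn0)
  have h3 := mul_le_mul_of_nonneg_left (hH x) (zero_le_one.trans hn0)
  have h4 := mul_le_mul_of_nonneg_left hN2 (hs0.trans hsi.le)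
  have h5 : (C + i * C ^ 2) * min ε 1 ≤ (C + i * C ^ 2) * ε :=
    mul_le_mul_of_nonneg_left (min_le_left _ _) (by have := hs0.trans hsi.le; positivity)
  linarith
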